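/- \textbf{Theorem (Existence of magnetic equilibrium configurations).} Let $\Omega\subset\mathbb R^3$ be a bounded open set (in particular, any bounded domain), and let $j:\mathbb R^3\to[0,+\infty]$ be a measurable kernel such that (J1) $j(-z)=j(z)$ for all $z\in\mathbb R^3$; (J2) $\int_{\mathbb R^3}\min\{1,|z|^2\}\,j(z)\,dz<+\infty$; (J3) $j\notin L^1(B_R)$ for every $R>0$, where $B_R$ is the ball of radius $R$ centered at the origin. For $m\in L^2(\Omega;\mathbb R^3)$ let $$\mathcal J_\Omega(m)=\iint_{\Omega\times\Omega}j(x-y)\,|m(x)-m(y)|^2\,dx\,dy,\qquad \mathcal W_\Omega(m)=-\int_\Omega h_d[m](x)\cdot m(x)\,dx,$$ where the demagnetizing field $h_d[m]$ is the solution in $L^2(\mathbb R^3;\mathbb R^3)$ of $$\operatorname{div}(m\chi_\Omega+h_d[m])=0,\qquad \operatorname{curl}h_d[m]=0\qquad\text{in }\mathbb R^3$$ in the sense of distributions, $m\chi_\Omega$ being the extension of $m$ by zero outside $\Omega$. Let $$\mathcal X^j(\Omega;\mathbb S^2)=\{m\in L^2(\Omega;\mathbb R^3): |m|=1\text{ a.e.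 in }\Omega,\ \mathcal J_\Omega(m)<+\infty\}.$$ Then $h_d[m]$ exists and is unique for every $m\in L^2(\Omega;\mathbb R^3)$, and the micromagnetic energy $\mathcal E_\Omega=\mathcal J_\Omega+\mathcal W_\Omega$ has a minimizer in $\mathcal X^j(\Omega;\mathbb S^2)$: there is $m_*\in\mathcal X^j(\Omega;\mathbb S^2)$ with $\mathcal E_\Omega(m_*)\le\mathcal E_\Omega(m)$ for all $m\in\mathcal X^j(\Omega;\mathbb S^2)$. -/

import Mathlib

open MeasureTheory
open scoped ENNReal

namespace Micromagnetics

/-- Three-dimensional Euclidean space, with the Euclidean norm and Lebesgue measure. -/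
abbrev E3 : Type := EuclideanSpace ℝ (Fin 3)

/-- `L²(Ω; ℝ³)`. -/
abbrev L2Field (Ω : Set E3) : Type := Lp E3 2 (volume.restrict Ω)

/-- The nonlocal exchange energy `∬_{Ω × Ω} j(x - y) |m(x) - m(y)|² dx dy ∈ [0, ∞]`. -/
noncomputable def exchangeEnergy (j : E3 → ℝ≥0∞) (Ω : Set E3) (m : L2Field Ω) : ℝ≥0∞ :=
  ∫⁻ p : E3 × E3, j (p.1 - p.2) * ‖m p.1 - m p.2‖ₑ ^ 2
    ∂((volume.restrict Ω).prod (volume.restrict Ω))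

/-- The space `𝒳^j(Ω; 𝕊²)` of `L²` fields with values a.e. in the unit sphere and finite exchange
energy. -/
def finiteEnergySpace (j : E3 → ℝ≥0∞) (Ω : Set E3) : Set (L2Field Ω) :=
  {m | (∀ᵐ x ∂(volume.restrict Ω), m x ∈ Metric.sphere (0 : E3) 1) ∧ exchangeEnergy j Ω m < ∞}

/-- Test functions: real-valued, smooth and compactly supported on `ℝ³`. -/
def IsTestFunction (φ : E3 → ℝ) : Prop :=
  ContDiff ℝ ((⊤ : ℕ∞) : WithTop ℕ∞) φ ∧ HasCompactSupport φ

/-- The partial derivative `∂ᵢ φ`. -/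
noncomputable def partialDeriv (i : Fin 3) (φ : E3 → ℝ) (x : E3) : ℝ :=
  fderiv ℝ φ x (EuclideanSpace.single i 1)

/-- `div F = 0` in the sense of distributions on `ℝ³`. -/
def DistribDivFree (F : E3 → E3) : Prop :=
  ∀ φ : E3 → ℝ, IsTestFunction φ → (∫ x, (∑ i, F x i * partialDeriv i φ x)) = 0

/-- `curl F = 0` in the sense of distributions on `ℝ³`: every component `∂ᵢ Fₖ - ∂ₖ Fᵢ` of the
curl vanishes. -/
def DistribCurlFree (F : E3 → E3) : Prop :=
  ∀ i k : Fin 3, ∀ φ : E3 → ℝ, IsTestFunction φ →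
    (∫ x, (F x k * partialDeriv i φ x - F x i * partialDeriv k φ x)) = 0

/-- `h ∈ L²(ℝ³; ℝ³)` solves the magnetostatic equations
`div (m χ_Ω + h) = 0`, `curl h = 0` in `ℝ³`. -/
def IsDemagField (Ω : Set E3) (m : L2Field Ω) (h : Lp E3 2 (volume : Measure E3)) : Prop :=
  DistribDivFree (fun x => Ω.indicator m x + h x) ∧ DistribCurlFree h

/-- The demagnetizing field `h_d[m]`: the solution in `L²(ℝ³; ℝ³)` of the magnetostatic equations. -/
noncomputable def demagField (Ω : Set E3) (m : L2Field Ω) : Lp E3 2 (volume : Measure E3) :=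
  Classical.epsilon (IsDemagField Ω m)

/-- The magnetostatic self-energy `-∫_Ω h_d[m] · m dx`. -/
noncomputable def magnetostaticEnergy (Ω : Set E3) (m : L2Field Ω) : ℝ :=
  -∫ x in Ω, inner ℝ (demagField Ω m x) (m x)

/-- The micromagnetic energy: exchange plus magnetostatic energy. It is used only on
`finiteEnergySpace j Ω`, where the exchange energy is finite, so that `toReal` loses nothing. -/
noncomputable def micromagneticEnergy (j : E3 → ℝ≥0∞) (Ω : Set E3) (m : L2Field Ω) : ℝ :=
  (exchangeEnergy j Ω m).toReal + magnetostaticEnergy Ω m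

end Micromagnetics

namespace Micromagnetics

open Filter Topology

/-! ### Fourier analysis of first-order distributional equations; uniqueness of the demagnetizing
field. -/

section DemagnetizingField

open SchwartzMap FourierTransform
open scoped LineDeriv ContDiff

/-! The proof is the direct method: the magnetostatic part is continuous on `L²`, and finite
exchange energy gives strong compactness.

Let `P` be the orthogonal projection onto the closure of gradients of test functions. With `m`
extended by zero, `m - P m` is orthogonal to all gradients, hence divergence free, and `P m` is curl
free, so `-P m` is a demagnetizing field. It is the only one: the Fourier transform `g` of a
difference satisfies `∑ ξᵢ gᵢ = 0` and `ξᵢ gₖ = ξₖ gᵢ`, whence `|ξ|² gₖ = 0`. The magnetostatic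
energy is therefore `‖P m‖²`, nonnegative and continuous (`magnetostaticEnergy_eq`).

For compactness put `D = m_p - m_q`, `k = min(j, n)` and `A(x) = ∫_Ω k(x - y) dy`. Then `A(x) D(x) =
∫ k(x - y) D(y) dy + ∫ k(x - y) (D(x) - D(y)) dy`. By Cauchy-Schwarz, where `A ≥ c` the second term
contributes to `|D|²` at most `2/c` times an exchange density. Non-integrability of `j` at the
origin makes `{A < c}` small for large `n`, and `|D| ≤ 2` there. The first term vanishes in the
limit along weakly convergent sequences, because `k` is bounded. Choosing `c`, then `n`, then `p, q`
gives a Cauchy subsequence (`exists_subseq_tendsto_of_exchangeEnergy_le`). Fatou's lemma and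
closedness of the sphere finish the argument. -/

lemma partialDeriv_mul {f g : E3 → ℝ} {x : E3} (hf : DifferentiableAt ℝ f x)
    (hg : DifferentiableAt ℝ g x) (i : Fin 3) :
    partialDeriv i (fun y => f y * g y) x = f x * partialDeriv i g x + g x * partialDeriv i f x := by
  simp [partialDeriv, fderiv_fun_mul hf hg]

lemma partialDeriv_comp_smul {f : E3 → ℝ} (hf : Differentiable ℝ f) (c : ℝ) (i : Fin 3) (x : E3) :
    partialDeriv i (fun y => f (c • y)) x = c * partialDeriv i f (c • x) := by
  have h1 : HasFDerivAt (fun y : E3 => c • y) (c • ContinuousLinearMap.id ℝ E3) x :=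
    (hasFDerivAt_id x).const_smul c
  have h2 := (hf (c • x)).hasFDerivAt.comp x h1
  simp only [partialDeriv]
  rw [show (fun y => f (c • y)) = f ∘ (fun y => c • y) from rfl, h2.fderiv]
  simp

lemma continuous_partialDeriv {f : E3 → ℝ} (hf : ContDiff ℝ ∞ f) (i : Fin 3) :
    Continuous (partialDeriv i f) :=
  (hf.continuous_fderiv (by simp)).clm_apply continuous_const

lemma hasCompactSupport_partialDeriv {f : E3 → ℝ} (hf : HasCompactSupport f) (i : Fin 3) :
    HasCompactSupport (partialDeriv i f) :=
  hf.fderiv_apply ℝ _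

/-- A distributional first-order equation with square-integrable coefficients may be tested with
smooth functions that are square integrable together with their first derivatives. -/
lemma integral_sum_mul_partialDeriv_eq_zero {G : Fin 3 → E3 → ℝ}
    (hG : ∀ i, MemLp (G i) 2 volume)
    (h : ∀ φ : E3 → ℝ, IsTestFunction φ → ∫ x, ∑ i, G i x * partialDeriv i φ x = 0)
    {u : E3 → ℝ} (hu : ContDiff ℝ ∞ u) (hu2 : MemLp u 2 volume)
    (hdu : ∀ i, MemLp (partialDeriv i u) 2 volume) :
    ∫ x, ∑ i, G i x * partialDeriv i u x = 0 := by
  -- `χ` is 1 near the origin, so `χ (c n • x)` tends to 1 as `c n → 0`, while its gradient is at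
  -- most `c n * M`. Since `c n ≤ 1`, one dominating function serves all `n`.
  let χ : ContDiffBump (0 : E3) := ⟨1, 2, one_pos, one_lt_two⟩
  have hχ : ContDiff ℝ ∞ χ := χ.contDiff
  have hχd : Differentiable ℝ χ := hχ.differentiable (by simp)
  obtain ⟨M, hM⟩ : ∃ M, ∀ i x, |partialDeriv i χ x| ≤ M := by
    have : ∀ i, ∃ M, ∀ x, |partialDeriv i χ x| ≤ M := fun i =>
      (hasCompactSupport_partialDeriv χ.hasCompactSupport i).exists_bound_of_continuous
        (continuous_partialDeriv hχ i)
    choose M hM using this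
    refine ⟨∑ i, |M i|, fun i x => (hM i x).trans ((le_abs_self _).trans ?_)⟩
    exact Finset.single_le_sum (f := fun i => |M i|) (fun i _ => abs_nonneg _) (Finset.mem_univ i)
  let c : ℕ → ℝ := fun n => 1 / ((n : ℝ) + 1)
  have hc0 : ∀ n, 0 < c n := fun n => by positivity
  have hc1 : ∀ n, c n ≤ 1 := fun n => by
    simp only [c]; rw [div_le_one (by positivity)]; linarith [Nat.cast_nonneg (α := ℝ) n]
  have hclim : Tendsto c atTop (𝓝 0) := tendsto_one_div_add_atTop_nhds_zero_nat
  let φ : ℕ → E3 → ℝ := fun n x => χ (c n • x) * u x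
  have hφχ : ∀ n, ContDiff ℝ ∞ (fun x : E3 => χ (c n • x)) := fun n =>
    hχ.comp (contDiff_const_smul (c n))
  have hφ : ∀ n, IsTestFunction (φ n) := fun n =>
    ⟨(hφχ n).mul hu, (χ.hasCompactSupport.comp_smul (hc0 n).ne').mul_right⟩
  have hφd : ∀ n i x, partialDeriv i (φ n) x =
      χ (c n • x) * partialDeriv i u x + u x * (c n * partialDeriv i χ (c n • x)) := by
    intro n i x
    rw [partialDeriv_mul (((hφχ n).differentiable (by simp)) x) ((hu.differentiable (by simp)) x),
      partialDeriv_comp_smul hχd]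
  have hM0 : 0 ≤ M := (abs_nonneg _).trans (hM 0 0)
  have key : Tendsto (fun n => ∫ x, ∑ i, G i x * partialDeriv i (φ n) x) atTop
      (𝓝 (∫ x, ∑ i, G i x * partialDeriv i u x)) := by
    refine tendsto_integral_of_dominated_convergence
      (fun x => ∑ i, (|G i x * partialDeriv i u x| + M * |G i x * u x|)) ?_ ?_ ?_ ?_
    · intro n
      exact Finset.aestronglyMeasurable_fun_sum _ fun i _ => (hG i).1.mul
        (continuous_partialDeriv (hφ n).1 i).aestronglyMeasurable
    · refine integrable_finsetSum _ fun i _ => ?_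
      exact ((hG i).integrable_mul (hdu i)).abs.add (((hG i).integrable_mul hu2).abs.const_mul M)
    · intro n
      refine Eventually.of_forall fun x => ?_
      rw [Real.norm_eq_abs]
      refine (Finset.abs_sum_le_sum_abs _ _).trans (Finset.sum_le_sum fun i _ => ?_)
      rw [hφd, mul_add]
      refine (abs_add_le _ _).trans (add_le_add ?_ ?_)
      · rw [mul_left_comm, abs_mul, abs_of_nonneg χ.nonneg]
        exact mul_le_of_le_one_left (abs_nonneg _) χ.le_one
      · rw [← mul_assoc, abs_mul, mul_comm, abs_mul, abs_of_pos (hc0 n)]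
        refine mul_le_mul_of_nonneg_right ?_ (abs_nonneg _)
        exact (mul_le_of_le_one_left (abs_nonneg _) (hc1 n)).trans (hM _ _)
    · refine Eventually.of_forall fun x => ?_
      refine tendsto_finsetSum _ fun i _ => Tendsto.const_mul _ ?_
      simp only [hφd]
      have hx : Tendsto (fun n => c n • x) atTop (𝓝 0) := by
        simpa using hclim.smul_const x
      have h1 : Tendsto (fun n => χ (c n • x)) atTop (𝓝 1) := by
        have := (χ.continuous.tendsto 0).comp hx
        rwa [χ.one_of_mem_closedBall (by simp [χ.rIn_pos.le])] at this
      have h2 : Tendsto (fun n => c n * partialDeriv i χ (c n • x)) atTop (𝓝 0) := by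
        have := hclim.mul (((continuous_partialDeriv hχ i).tendsto 0).comp hx)
        simpa using this
      simpa using (h1.mul_const (partialDeriv i u x)).add (h2.const_mul (u x))
  have hzero : (fun n => ∫ x, ∑ i, G i x * partialDeriv i (φ n) x) = fun _ => 0 :=
    funext fun n => h _ (hφ n)
  rw [hzero] at key
  exact (tendsto_nhds_unique key tendsto_const_nhds)

/-- Real and imaginary parts of a Schwartz function are admissible in the previous lemma; since `G`
is real, the two identities combine into a complex one. -/
lemma sum_inner_lineDeriv_eq_zero {G : Fin 3 → E3 → ℝ} (hG : ∀ i, MemLp (G i) 2 volume)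
    (h : ∀ φ : E3 → ℝ, IsTestFunction φ → ∫ x, ∑ i, G i x * partialDeriv i φ x = 0)
    (f : 𝓢(E3, ℂ)) :
    ∑ i, inner ℂ ((hG i).ofReal (K := ℂ)).toLp
      ((∂_{EuclideanSpace.single i (1 : ℝ)} f).toLp 2 volume) = 0 := by
  have hd : ∀ (L : ℂ →L[ℝ] ℝ) i x, partialDeriv i (fun y => L (f y)) x =
      L ((∂_{EuclideanSpace.single i (1 : ℝ)} f) x) := by
    intro L i x
    simp only [partialDeriv]
    rw [show (fun y => L (f y)) = L ∘ f from rfl,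
      (L.hasFDerivAt.comp x f.differentiableAt.hasFDerivAt).fderiv]
    rfl
  have hL : ∀ L : ℂ →L[ℝ] ℝ, ∫ x, ∑ i, G i x *
      L ((∂_{EuclideanSpace.single i (1 : ℝ)} f) x) = 0 := by
    intro L
    have := integral_sum_mul_partialDeriv_eq_zero hG h (u := fun y => L (f y))
      (L.contDiff.comp (f.smooth ⊤)) (L.comp_memLp' (f.memLp 2))
      (fun i => by
        have h1 := L.comp_memLp' ((∂_{EuclideanSpace.single i (1 : ℝ)} f).memLp 2 volume)
        refine h1.congr_norm ?_ ?_
        · exact ((continuous_partialDeriv (L.contDiff.comp (f.smooth ⊤)) i)).aestronglyMeasurable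
        · exact Eventually.of_forall fun x => by rw [hd]; rfl)
    simpa only [hd] using this
  have hint : ∀ i, Integrable (fun x => (G i x : ℂ) *
      (∂_{EuclideanSpace.single i (1 : ℝ)} f) x) volume := fun i =>
    ((hG i).ofReal (K := ℂ)).integrable_mul ((∂_{EuclideanSpace.single i (1 : ℝ)} f).memLp 2 volume)
  have hin : ∀ i, inner ℂ ((hG i).ofReal (K := ℂ)).toLp
      ((∂_{EuclideanSpace.single i (1 : ℝ)} f).toLp 2 volume) =
      ∫ x, (G i x : ℂ) * (∂_{EuclideanSpace.single i (1 : ℝ)} f) x := by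
    intro i
    rw [L2.inner_def]
    refine integral_congr_ae ?_
    filter_upwards [((hG i).ofReal (K := ℂ)).coeFn_toLp,
      (∂_{EuclideanSpace.single i (1 : ℝ)} f).coeFn_toLp 2 volume] with x h1 h2
    rw [h1, h2, RCLike.inner_apply]
    simp [mul_comm]
  simp_rw [hin]
  rw [← integral_finsetSum _ fun i _ => hint i]
  have hI := integrable_finsetSum Finset.univ fun i _ => hint i
  apply Complex.ext
  · have := Complex.reCLM.integral_comp_comm hI
    rw [Complex.reCLM_apply] at this
    rw [← this]
    simpa using hL Complex.reCLM
  · have := Complex.imCLM.integral_comp_comm hI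
    rw [Complex.imCLM_apply] at this
    rw [← this]
    simpa using hL Complex.imCLM

/-- Fourier side of a distributional first-order equation. -/
lemma ae_sum_mul_fourier_eq_zero {G : Fin 3 → E3 → ℝ} (hG : ∀ i, MemLp (G i) 2 volume)
    (h : ∀ φ : E3 → ℝ, IsTestFunction φ → ∫ x, ∑ i, G i x * partialDeriv i φ x = 0) :
    ∀ᵐ ξ : E3, ∑ i, ((ξ i : ℝ) : ℂ) * (𝓕 ((hG i).ofReal (K := ℂ)).toLp : Lp ℂ 2 volume) ξ = 0 := by
  set g : Fin 3 → Lp ℂ 2 (volume : Measure E3) := fun i => 𝓕 ((hG i).ofReal (K := ℂ)).toLp with hg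
  have hcont : ∀ i : Fin 3, Continuous fun ξ : E3 => ((ξ i : ℝ) : ℂ) := fun i => by fun_prop
  have hloc : ∀ i, LocallyIntegrable (fun ξ : E3 => ((ξ i : ℝ) : ℂ) • (g i) ξ) volume := fun i =>
    LocallyIntegrable.continuous_smul (hcont i) ((Lp.memLp (g i)).locallyIntegrable one_le_two)
  have hlocs : LocallyIntegrable (fun ξ : E3 => ∑ i, ((ξ i : ℝ) : ℂ) * (g i) ξ) volume :=
    locallyIntegrable_finsetSum _ fun i _ => hloc i
  refine ae_eq_zero_of_integral_contDiff_smul_eq_zero hlocs fun ψ hψ hψc => ?_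
  have hψ' : ContDiff ℝ ∞ fun x => (ψ x : ℂ) := Complex.ofRealCLM.contDiff.comp hψ
  have hψc' : HasCompactSupport fun x => (ψ x : ℂ) := hψc.comp_left (g := Complex.ofReal) rfl
  let Ψ : 𝓢(E3, ℂ) := hψc'.toSchwartzMap hψ'
  have hΨ : ∀ x, Ψ x = (ψ x : ℂ) := fun x => rfl
  -- Testing with `𝓕⁻ Ψ` makes Plancherel turn each derivative into multiplication of `Ψ` by `2πi
  -- ξᵢ`. The conjugate below comes from conjugate-linearity of the inner product in its first slot.
  have key := sum_inner_lineDeriv_eq_zero hG h (𝓕⁻ Ψ)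
  have hF : ∀ i, inner ℂ ((hG i).ofReal (K := ℂ)).toLp
      ((∂_{EuclideanSpace.single i (1 : ℝ)} (𝓕⁻ Ψ)).toLp 2 volume) =
      (2 * Real.pi * Complex.I) * (starRingEnd ℂ) (∫ ξ : E3, ψ ξ • (((ξ i : ℝ) : ℂ) * (g i) ξ)) := by
    intro i
    rw [← Lp.inner_fourier_eq, toLp_fourier_eq, fourier_lineDerivOp_eq, fourier_fourierInv_eq,
      L2.inner_def, ← integral_conj, ← integral_const_mul]
    refine integral_congr_ae ?_
    filter_upwards [((2 * Real.pi * Complex.I : ℂ) • (smulLeftCLM ℂ fun x : E3 =>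
      inner ℝ x (EuclideanSpace.single i (1 : ℝ))) Ψ).coeFn_toLp 2 volume] with x hx
    rw [hx, RCLike.inner_apply, smul_apply, smulLeftCLM_apply_apply (by fun_prop), hΨ]
    simp [EuclideanSpace.inner_single_right, hg]
    ring
  simp_rw [hF] at key
  rw [← Finset.mul_sum, ← map_sum] at key
  have hpi : (2 * Real.pi * Complex.I : ℂ) ≠ 0 := by simp [Real.pi_ne_zero]
  have key2 := (map_eq_zero _).1 ((mul_eq_zero.1 key).resolve_left hpi)
  rw [← integral_finsetSum] at key2
  · simpa [Finset.mul_sum, hg] using key2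
  · intro i _
    exact (hloc i).integrable_smul_left_of_hasCompactSupport hψ.continuous hψc

lemma memLp_apply {h : E3 → E3} (hh : MemLp h 2 volume) (k : Fin 3) :
    MemLp (fun x => h x k) 2 volume :=
  (EuclideanSpace.proj (𝕜 := ℝ) k : E3 →L[ℝ] ℝ).comp_memLp' hh

/-- A square-integrable field on `ℝ³` that is both divergence free and curl free vanishes. -/
theorem ae_eq_zero_of_distribDivFree_of_distribCurlFree {h : E3 → E3} (hh : MemLp h 2 volume)
    (hdiv : DistribDivFree h) (hcurl : DistribCurlFree h) : ∀ᵐ x : E3, h x = 0 := by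
  have hk := fun k => (memLp_apply hh k)
  set g : Fin 3 → Lp ℂ 2 (volume : Measure E3) :=
    fun i => 𝓕 ((hk i).ofReal (K := ℂ)).toLp with hg
  have hdivF : ∀ᵐ ξ : E3, ∑ i, ((ξ i : ℝ) : ℂ) * (g i) ξ = 0 :=
    ae_sum_mul_fourier_eq_zero hk hdiv
  have hcurlF : ∀ i k : Fin 3, ∀ᵐ ξ : E3,
      ((ξ i : ℝ) : ℂ) * (g k) ξ = ((ξ k : ℝ) : ℂ) * (g i) ξ := by
    intro i k
    rcases eq_or_ne i k with rfl | hik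
    · simp
    -- With these coefficients a component of the curl equation becomes a divergence equation, so
    -- the same Fourier lemma applies.
    let G : Fin 3 → E3 → ℝ := fun l x =>
      (if l = i then 1 else 0) * h x k - (if l = k then 1 else 0) * h x i
    have hG : ∀ l, MemLp (G l) 2 volume := fun l => ((hk k).const_mul _).sub ((hk i).const_mul _)
    have hGF := ae_sum_mul_fourier_eq_zero hG (fun φ hφ => by
      rw [← hcurl i k φ hφ]
      refine integral_congr_ae (Eventually.of_forall fun x => ?_)
      simp [G, sub_mul, Finset.sum_sub_distrib])
    have hGg : ∀ l, (𝓕 ((hG l).ofReal (K := ℂ)).toLp : Lp ℂ 2 volume) =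
        (if l = i then (1 : ℂ) else 0) • g k - (if l = k then (1 : ℂ) else 0) • g i := by
      intro l
      have : ((hG l).ofReal (K := ℂ)).toLp = (if l = i then (1 : ℂ) else 0) •
          ((hk k).ofReal (K := ℂ)).toLp - (if l = k then (1 : ℂ) else 0) •
          ((hk i).ofReal (K := ℂ)).toLp := by
        rw [← MemLp.toLp_const_smul, ← MemLp.toLp_const_smul, ← MemLp.toLp_sub]
        refine MemLp.toLp_congr _ _ (Eventually.of_forall fun x => ?_)
        simp only [G, Pi.sub_apply, Pi.smul_apply]
        split_ifs <;> simp
      rw [this, sub_eq_add_neg, FourierAdd.fourier_add, FourierTransform.fourier_neg,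
        FourierSMul.fourier_smul, FourierSMul.fourier_smul, ← sub_eq_add_neg]
    have hae : ∀ l, ∀ᵐ ξ : E3, (𝓕 ((hG l).ofReal (K := ℂ)).toLp : Lp ℂ 2 volume) ξ =
        (if l = i then (1 : ℂ) else 0) * g k ξ - (if l = k then (1 : ℂ) else 0) * g i ξ := by
      intro l
      rw [hGg l]
      filter_upwards [Lp.coeFn_sub ((if l = i then (1 : ℂ) else 0) • g k)
        ((if l = k then (1 : ℂ) else 0) • g i), Lp.coeFn_smul (if l = i then (1 : ℂ) else 0) (g k),
        Lp.coeFn_smul (if l = k then (1 : ℂ) else 0) (g i)] with ξ h1 h2 h3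
      rw [h1, Pi.sub_apply, h2, h3]
      rfl
    filter_upwards [hGF, ae_all_iff.2 hae] with ξ h1 h2
    simp only [h2, mul_sub, Finset.sum_sub_distrib] at h1
    simpa [sub_eq_zero] using h1
  have hg0 : ∀ k, g k = 0 := by
    intro k
    rw [Lp.eq_zero_iff_ae_eq_zero]
    have hne : ∀ᵐ ξ : E3, ξ ≠ 0 := by
      simp [ae_iff]
    filter_upwards [hdivF, ae_all_iff.2 fun i => hcurlF i k, hne] with ξ h1 h2 h3
    -- `∑ ξᵢ (ξᵢ gₖ) = ξₖ ∑ ξᵢ gᵢ = 0`: the curl relation, then the divergence relation.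
    have h4 : (∑ i, ((ξ i : ℝ) : ℂ) * ((ξ i : ℝ) : ℂ)) * g k ξ = 0 := by
      rw [Finset.sum_mul]
      simp_rw [mul_assoc, h2, mul_left_comm _ ((ξ k : ℝ) : ℂ)]
      rw [← Finset.mul_sum, h1, mul_zero]
    refine (mul_eq_zero.1 h4).resolve_left ?_
    have : (∑ i, ((ξ i : ℝ) : ℂ) * ((ξ i : ℝ) : ℂ)) = ((‖ξ‖ ^ 2 : ℝ) : ℂ) := by
      rw [EuclideanSpace.norm_sq_eq]
      push_cast
      refine Finset.sum_congr rfl fun i _ => ?_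
      rw [Real.norm_eq_abs, ← sq, ← Complex.ofReal_pow, ← Complex.ofReal_pow, sq_abs]
    rw [this]
    exact_mod_cast pow_ne_zero 2 (norm_ne_zero_iff.2 h3)
  have hk0 : ∀ k, ∀ᵐ x : E3, h x k = 0 := by
    intro k
    have h1 : ((hk k).ofReal (K := ℂ)).toLp = 0 := by
      rw [← norm_eq_zero, ← Lp.norm_fourier_eq]
      exact norm_eq_zero.2 (hg0 k)
    filter_upwards [((hk k).ofReal (K := ℂ)).coeFn_toLp,
      (Lp.eq_zero_iff_ae_eq_zero.1 h1)] with x h2 h3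
    rw [h2] at h3
    simpa using h3
  filter_upwards [ae_all_iff.2 hk0] with x hx
  ext k
  simpa using hx k

/-! ### Existence of the demagnetizing field by projection onto gradients. -/

lemma continuous_single (i : Fin 3) : Continuous fun a : ℝ => (EuclideanSpace.single i a : E3) := by
  have : (fun a : ℝ => (EuclideanSpace.single i a : E3)) =
      fun a => a • EuclideanSpace.single i (1 : ℝ) := by
    ext a k; simp
  rw [this]; fun_prop

/-- The gradient of a test function is square integrable. -/
lemma memLp_gradient {φ : E3 → ℝ} (hφ : IsTestFunction φ) :
    MemLp (fun x => ∑ i, EuclideanSpace.single i (partialDeriv i φ x) : E3 → E3) 2 volume := by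
  refine memLp_finsetSum _ fun i _ => Continuous.memLp_of_hasCompactSupport
    ((continuous_single i).comp (continuous_partialDeriv hφ.1 i)) ?_
  exact (hasCompactSupport_partialDeriv hφ.2 i).comp_left
    (g := fun a : ℝ => (EuclideanSpace.single i a : E3)) (by simp)

/-- The test fields for the components of the curl are square integrable. -/
lemma memLp_curlTest {φ : E3 → ℝ} (hφ : IsTestFunction φ) (i k : Fin 3) :
    MemLp (fun x => EuclideanSpace.single k (partialDeriv i φ x) -
      EuclideanSpace.single i (partialDeriv k φ x) : E3 → E3) 2 volume := by
  have h : ∀ i k : Fin 3, MemLp (fun x => EuclideanSpace.single k (partialDeriv i φ x) : E3 → E3)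
      2 volume := fun i k => Continuous.memLp_of_hasCompactSupport
    ((continuous_single k).comp (continuous_partialDeriv hφ.1 i))
    ((hasCompactSupport_partialDeriv hφ.2 i).comp_left
      (g := fun a : ℝ => (EuclideanSpace.single k a : E3)) (by simp))
  exact (h i k).sub (h k i)

lemma inner_toLp_eq_integral {f : Lp E3 2 (volume : Measure E3)} {F w : E3 → E3}
    (hF : F =ᵐ[volume] f) (hw : MemLp w 2 volume) :
    inner ℝ f hw.toLp = ∫ x, inner ℝ (F x) (w x) := by
  rw [L2.inner_def]
  refine integral_congr_ae ?_
  filter_upwards [hF, hw.coeFn_toLp] with x h1 h2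
  rw [h1, h2]

lemma distribDivFree_iff {f : Lp E3 2 (volume : Measure E3)} {F : E3 → E3}
    (hF : F =ᵐ[volume] f) :
    DistribDivFree F ↔
      ∀ φ : E3 → ℝ, ∀ hφ : IsTestFunction φ, inner ℝ f (memLp_gradient hφ).toLp = 0 := by
  refine forall_congr' fun φ => forall_congr' fun hφ => ?_
  rw [inner_toLp_eq_integral hF]
  simp [inner_sum, EuclideanSpace.inner_single_right, mul_comm]

lemma distribCurlFree_iff {f : Lp E3 2 (volume : Measure E3)} {F : E3 → E3}
    (hF : F =ᵐ[volume] f) :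
    DistribCurlFree F ↔ ∀ i k : Fin 3, ∀ φ : E3 → ℝ, ∀ hφ : IsTestFunction φ,
      inner ℝ f (memLp_curlTest hφ i k).toLp = 0 := by
  refine forall_congr' fun i => forall_congr' fun k => forall_congr' fun φ =>
    forall_congr' fun hφ => ?_
  rw [inner_toLp_eq_integral hF]
  simp [inner_sub_right, EuclideanSpace.inner_single_right, mul_comm]

/-- Integration by parts gives `-∫ ∂ₖ∂ᵢφ ψ` on one side and `-∫ ∂ᵢ∂ₖφ ψ` on the other; mixed
derivatives commute. -/
lemma integral_partialDeriv_mul_comm {φ ψ : E3 → ℝ} (hφ : IsTestFunction φ)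
    (hψ : IsTestFunction ψ) (i k : Fin 3) :
    ∫ x, partialDeriv i φ x * partialDeriv k ψ x = ∫ x, partialDeriv k φ x * partialDeriv i ψ x := by
  let f : 𝓢(E3, ℝ) := hφ.2.toSchwartzMap hφ.1
  let g : 𝓢(E3, ℝ) := hψ.2.toSchwartzMap hψ.1
  let e : Fin 3 → E3 := fun i => EuclideanSpace.single i (1 : ℝ)
  have hcomm : ∀ x, (∂_{e k} (∂_{e i} f)) x = (∂_{e i} (∂_{e k} f)) x := by
    intro x
    have h2 : HasFDerivAt (fderiv ℝ φ) (fderiv ℝ (fderiv ℝ φ) x) x :=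
      ((hφ.1.fderiv_right (m := ∞) (by simp)).differentiable (by simp) x).hasFDerivAt
    have hsymm := second_derivative_symmetric
      (fun y => (hφ.1.differentiable (by simp) y).hasFDerivAt) h2
    have : ∀ a b : E3, (∂_{b} (∂_{a} f)) x = fderiv ℝ (fderiv ℝ φ) x b a := by
      intro a b
      rw [lineDerivOp_apply_eq_fderiv]
      have h3 := h2.clm_apply (hasFDerivAt_const a x)
      have : (⇑(∂_{a} f : 𝓢(E3, ℝ)) : E3 → ℝ) = fun y => fderiv ℝ φ y a := rfl
      rw [this, h3.fderiv]
      simp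
    rw [this, this, hsymm]
  have h1 := integral_mul_lineDerivOp_right_eq_neg_left (μ := volume) (∂_{e i} f) g (e k)
  have h2 := integral_mul_lineDerivOp_right_eq_neg_left (μ := volume) (∂_{e k} f) g (e i)
  simp only [hcomm] at h1
  exact h1.trans h2.symm

/-- The closure in `L²(ℝ³; ℝ³)` of the gradients of test functions. -/
noncomputable def gradientSpace : Submodule ℝ (Lp E3 2 (volume : Measure E3)) :=
  (Submodule.span ℝ {g | ∃ φ, ∃ hφ : IsTestFunction φ, g = (memLp_gradient hφ).toLp}).topologicalClosure

instance : CompleteSpace gradientSpace :=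
  (Submodule.isClosed_topologicalClosure _).completeSpace_coe

lemma gradient_mem_gradientSpace {φ : E3 → ℝ} (hφ : IsTestFunction φ) :
    (memLp_gradient hφ).toLp ∈ gradientSpace :=
  Submodule.le_topologicalClosure _ (Submodule.subset_span ⟨φ, hφ, rfl⟩)

/-- Each curl test is a continuous linear functional, so its kernel is a closed subspace; it
suffices to check gradients of test functions. -/
lemma distribCurlFree_of_mem_gradientSpace {h : Lp E3 2 (volume : Measure E3)}
    (hh : h ∈ gradientSpace) : DistribCurlFree h := by
  rw [distribCurlFree_iff (EventuallyEq.refl _ _)]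
  intro i k ψ hψ
  have hle : gradientSpace ≤ (innerSL ℝ (memLp_curlTest hψ i k).toLp).ker := by
    refine Submodule.topologicalClosure_minimal _ (Submodule.span_le.2 ?_)
      (ContinuousLinearMap.isClosed_ker _)
    rintro _ ⟨φ, hφ, rfl⟩
    have h1 := (distribCurlFree_iff (memLp_gradient hφ).coeFn_toLp.symm).1 ?_ i k ψ hψ
    · simpa [real_inner_comm] using h1
    · intro i k ψ hψ
      have hint : ∀ i k, Integrable (fun x => partialDeriv i φ x * partialDeriv k ψ x) :=
        fun i k => ((continuous_partialDeriv hφ.1 i).mul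
          (continuous_partialDeriv hψ.1 k)).integrable_of_hasCompactSupport
          (hasCompactSupport_partialDeriv hφ.2 i).mul_right
      simp [Pi.single_apply]
      rw [integral_sub (hint k i) (hint i k), integral_partialDeriv_mul_comm hφ hψ, sub_self]
  simpa [real_inner_comm] using hle hh

/-- Extension by zero from `L²(Ω; ℝ³)` to `L²(ℝ³; ℝ³)`. -/
noncomputable def zeroExtension {Ω : Set E3} (hΩ : MeasurableSet Ω) (m : L2Field Ω) :
    Lp E3 2 (volume : Measure E3) :=
  ((memLp_indicator_iff_restrict hΩ).2 (Lp.memLp m)).toLp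

lemma coeFn_zeroExtension {Ω : Set E3} (hΩ : MeasurableSet Ω) (m : L2Field Ω) :
    zeroExtension hΩ m =ᵐ[volume] Ω.indicator m :=
  MemLp.coeFn_toLp _

lemma inner_zeroExtension {Ω : Set E3} (hΩ : MeasurableSet Ω) (m : L2Field Ω)
    (h : Lp E3 2 (volume : Measure E3)) :
    inner ℝ h (zeroExtension hΩ m) = ∫ x in Ω, inner ℝ (h x) (m x) := by
  rw [L2.inner_def, ← integral_indicator hΩ]
  refine integral_congr_ae ?_
  filter_upwards [coeFn_zeroExtension hΩ m] with x hx
  rw [hx]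
  by_cases hxΩ : x ∈ Ω <;> simp [hxΩ]

lemma dist_zeroExtension {Ω : Set E3} (hΩ : MeasurableSet Ω) (m m' : L2Field Ω) :
    dist (zeroExtension hΩ m) (zeroExtension hΩ m') = dist m m' := by
  rw [Lp.dist_def, Lp.dist_def]
  congr 1
  rw [← eLpNorm_indicator_eq_eLpNorm_restrict hΩ]
  refine eLpNorm_congr_ae ?_
  filter_upwards [coeFn_zeroExtension hΩ m, coeFn_zeroExtension hΩ m'] with x h1 h2
  simp only [Pi.sub_apply, h1, h2]
  by_cases hxΩ : x ∈ Ω <;> simp [hxΩ]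

lemma indicator_add_ae_eq {Ω : Set E3} (hΩ : MeasurableSet Ω) (m : L2Field Ω)
    (h : Lp E3 2 (volume : Measure E3)) :
    (fun x => Ω.indicator m x + h x) =ᵐ[volume]
      (zeroExtension hΩ m + h : Lp E3 2 (volume : Measure E3)) := by
  filter_upwards [coeFn_zeroExtension hΩ m, Lp.coeFn_add (zeroExtension hΩ m) h] with x h1 h2
  rw [h2, Pi.add_apply, h1]

lemma isDemagField_neg_starProjection {Ω : Set E3} (hΩ : MeasurableSet Ω) (m : L2Field Ω) :
    IsDemagField Ω m (-gradientSpace.starProjection (zeroExtension hΩ m)) := by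
  refine ⟨(distribDivFree_iff (indicator_add_ae_eq hΩ m _)).2 fun φ hφ => ?_,
    distribCurlFree_of_mem_gradientSpace
      (neg_mem (Submodule.starProjection_apply_mem _ _))⟩
  rw [← sub_eq_add_neg]
  exact Submodule.starProjection_inner_eq_zero _ _ (gradient_mem_gradientSpace hφ)

lemma isDemagField_unique {Ω : Set E3} (hΩ : MeasurableSet Ω) {m : L2Field Ω}
    {h h' : Lp E3 2 (volume : Measure E3)} (hh : IsDemagField Ω m h) (hh' : IsDemagField Ω m h') :
    h = h' := by
  rw [← sub_eq_zero, Lp.eq_zero_iff_ae_eq_zero]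
  refine ae_eq_zero_of_distribDivFree_of_distribCurlFree (Lp.memLp _) ?_ ?_
  · rw [distribDivFree_iff (EventuallyEq.refl _ _)]
    intro φ hφ
    have h1 := (distribDivFree_iff (indicator_add_ae_eq hΩ m _)).1 hh.1 φ hφ
    have h2 := (distribDivFree_iff (indicator_add_ae_eq hΩ m _)).1 hh'.1 φ hφ
    rw [inner_add_left] at h1 h2
    rw [inner_sub_left]
    linarith
  · rw [distribCurlFree_iff (EventuallyEq.refl _ _)]
    intro i k φ hφ
    rw [inner_sub_left, (distribCurlFree_iff (EventuallyEq.refl _ _)).1 hh.2 i k φ hφ,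
      (distribCurlFree_iff (EventuallyEq.refl _ _)).1 hh'.2 i k φ hφ, sub_self]

lemma existsUnique_isDemagField {Ω : Set E3} (hΩ : MeasurableSet Ω) (m : L2Field Ω) :
    ∃! h : Lp E3 2 (volume : Measure E3), IsDemagField Ω m h :=
  ⟨_, isDemagField_neg_starProjection hΩ m, fun _ hh =>
    isDemagField_unique hΩ hh (isDemagField_neg_starProjection hΩ m)⟩

/-- Uniqueness pins down the value picked by `Classical.epsilon`. -/
lemma demagField_eq {Ω : Set E3} (hΩ : MeasurableSet Ω) (m : L2Field Ω) :
    demagField Ω m = -gradientSpace.starProjection (zeroExtension hΩ m) :=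
  isDemagField_unique hΩ (Classical.epsilon_spec ⟨_, isDemagField_neg_starProjection hΩ m⟩)
    (isDemagField_neg_starProjection hΩ m)

/-- An orthogonal projection satisfies `⟪P m, m⟫ = ‖P m‖²`. -/
lemma magnetostaticEnergy_eq {Ω : Set E3} (hΩ : MeasurableSet Ω) (m : L2Field Ω) :
    magnetostaticEnergy Ω m = ‖gradientSpace.starProjection (zeroExtension hΩ m)‖ ^ 2 := by
  rw [magnetostaticEnergy, ← inner_zeroExtension hΩ, demagField_eq hΩ, inner_neg_left, neg_neg,
    ← real_inner_self_eq_norm_sq]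
  have := Submodule.starProjection_inner_eq_zero (K := gradientSpace) (zeroExtension hΩ m) _
    (Submodule.starProjection_apply_mem gradientSpace (zeroExtension hΩ m))
  rw [inner_sub_left, real_inner_comm] at this
  linarith

lemma magnetostaticEnergy_nonneg {Ω : Set E3} (hΩ : MeasurableSet Ω) (m : L2Field Ω) :
    0 ≤ magnetostaticEnergy Ω m := by
  rw [magnetostaticEnergy_eq hΩ]; positivity

lemma continuous_magnetostaticEnergy {Ω : Set E3} (hΩ : MeasurableSet Ω) :
    Continuous (magnetostaticEnergy Ω) := by
  have h : Continuous (zeroExtension hΩ) :=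
    (Isometry.of_dist_eq (dist_zeroExtension hΩ)).continuous
  simp_rw [funext (magnetostaticEnergy_eq hΩ)]
  fun_prop

end DemagnetizingField

/-! ### Compactness from bounded exchange energy. -/

section Compactness

/-- Bounded sequences in a separable Hilbert space have weakly convergent subsequences. -/
lemma exists_subseq_tendsto_inner {H : Type*} [NormedAddCommGroup H] [InnerProductSpace ℝ H]
    [CompleteSpace H] [TopologicalSpace.SeparableSpace H] {u : ℕ → H} {r : ℝ}
    (hu : ∀ n, ‖u n‖ ≤ r) :
    ∃ v : H, ∃ φ : ℕ → ℕ, StrictMono φ ∧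
      ∀ g : H, Tendsto (fun n => inner ℝ (u (φ n)) g) atTop (𝓝 (inner ℝ v g)) := by
  obtain ⟨w, -, φ, hφ, hw⟩ := WeakDual.isSeqCompact_closedBall ℝ H 0 r
    (x := fun n => StrongDual.toWeakDual (InnerProductSpace.toDual ℝ H (u n))) (fun n => by
      simpa using hu n)
  refine ⟨(InnerProductSpace.toDual ℝ H).symm (WeakDual.toStrongDual w), φ, hφ, fun g => ?_⟩
  have h := ((WeakDual.eval_continuous g).tendsto w).comp hw
  refine (tendsto_congr fun n => ?_).1 (h.trans (by simp))
  exact InnerProductSpace.toDual_apply_apply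

lemma ennreal_add_sq_le (a b : ℝ≥0∞) : (a + b) ^ 2 ≤ 2 * a ^ 2 + 2 * b ^ 2 := by
  have h := ENNReal.rpow_add_le_mul_rpow_add_rpow a b one_le_two
  norm_num at h
  rwa [mul_add] at h

lemma enorm_add_sq_le {E : Type*} [NormedAddCommGroup E] (a b : E) :
    ‖a + b‖ₑ ^ 2 ≤ 2 * ‖a‖ₑ ^ 2 + 2 * ‖b‖ₑ ^ 2 :=
  (pow_le_pow_left₀ zero_le (enorm_add_le a b) 2).trans (ennreal_add_sq_le _ _)

/-- The Cauchy-Schwarz inequality for a weighted integral. -/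
lemma lintegral_mul_sq_le {α : Type*} [MeasurableSpace α] {μ : Measure α} {k f : α → ℝ≥0∞}
    (hk : Measurable k) (hf : Measurable f) :
    (∫⁻ y, k y * f y ∂μ) ^ 2 ≤ (∫⁻ y, k y ∂μ) * ∫⁻ y, k y * f y ^ 2 ∂μ := by
  -- Hölder for the pair `1, f` with respect to the measure `k dμ`.
  have h := ENNReal.lintegral_mul_le_Lp_mul_Lq (μ.withDensity k) Real.HolderConjugate.two_two
    (f := fun _ => 1) (g := f) aemeasurable_const hf.aemeasurable
  have hs : ∀ a : ℝ≥0∞, (a ^ (1 / 2 : ℝ)) ^ 2 = a := fun a => by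
    rw [← ENNReal.rpow_natCast, ← ENNReal.rpow_mul]; norm_num
  have h2 := pow_le_pow_left₀ zero_le h 2
  rw [mul_pow, hs, hs] at h2
  simp only [ENNReal.rpow_two] at h2
  rwa [lintegral_withDensity_eq_lintegral_mul _ hk (measurable_const.mul hf),
    lintegral_withDensity_eq_lintegral_mul _ hk measurable_const,
    lintegral_withDensity_eq_lintegral_mul _ hk (hf.pow_const 2),
    show (k * fun _ => (1 : ℝ≥0∞) ^ 2) = k by ext; simp,
    show (k * ((fun _ => (1 : ℝ≥0∞)) * f)) = fun y => k y * f y by ext; simp] at h2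

/-- The pointwise estimate behind compactness: averaging with respect to a finite weight. -/
lemma enorm_sq_le_of_weight {α E : Type*} [MeasurableSpace α] {μ : Measure α}
    [NormedAddCommGroup E] [NormedSpace ℝ E] [CompleteSpace E] [MeasurableSpace E] [BorelSpace E]
    [SecondCountableTopology E] {k : α → ℝ} (hk : Integrable k μ) (hkm : Measurable k)
    (hk0 : ∀ y, 0 ≤ k y) {D : α → E} (hD : Measurable D)
    (hkD : Integrable (fun y => k y • D y) μ) (x : α) {c : ℝ≥0∞} (hc0 : c ≠ 0)
    (hc : c ≤ ∫⁻ y, ENNReal.ofReal (k y) ∂μ) :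
    ‖D x‖ₑ ^ 2 ≤ 2 / c ^ 2 * ‖∫ y, k y • D y ∂μ‖ₑ ^ 2 +
      2 / c * ∫⁻ y, ENNReal.ofReal (k y) * ‖D x - D y‖ₑ ^ 2 ∂μ := by
  set A := ∫⁻ y, ENNReal.ofReal (k y) ∂μ with hA
  set B := ∫⁻ y, ENNReal.ofReal (k y) * ‖D x - D y‖ₑ ^ 2 ∂μ with hB
  have hA0 : A ≠ 0 := fun h => hc0 (le_zero_iff.1 (h ▸ hc))
  have hAt : A ≠ ∞ := by
    have := hk.lintegral_lt_top
    exact this.ne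
  have hkx : Integrable (fun y => k y • D x) μ := hk.smul_const (D x)
  have hid : (∫ y, k y ∂μ) • D x = (∫ y, k y • D y ∂μ) + ∫ y, k y • (D x - D y) ∂μ := by
    simp_rw [smul_sub]
    rw [integral_sub hkx hkD, integral_smul_const]
    abel
  have hAe : ‖∫ y, k y ∂μ‖ₑ = A := by
    rw [hA, ← ofReal_integral_eq_lintegral_ofReal hk (Eventually.of_forall hk0),
      Real.enorm_of_nonneg (integral_nonneg hk0)]
  have hCS : ‖∫ y, k y • (D x - D y) ∂μ‖ₑ ^ 2 ≤ A * B := by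
    refine le_trans ?_ (lintegral_mul_sq_le hkm.ennreal_ofReal (by fun_prop))
    gcongr
    refine (enorm_integral_le_lintegral_enorm _).trans (lintegral_mono fun y => ?_)
    rw [enorm_smul, Real.enorm_of_nonneg (hk0 y)]
  have h1 : A ^ 2 * ‖D x‖ₑ ^ 2 ≤ 2 * ‖∫ y, k y • D y ∂μ‖ₑ ^ 2 + 2 * (A * B) := by
    rw [← hAe, ← mul_pow, ← enorm_smul, hid, hAe]
    exact (enorm_add_sq_le _ _).trans (by gcongr)
  have h2 : ‖D x‖ₑ ^ 2 ≤ 2 / A ^ 2 * ‖∫ y, k y • D y ∂μ‖ₑ ^ 2 + 2 / A * B := by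
    have hA20 : A ^ 2 ≠ 0 := pow_ne_zero 2 hA0
    have hA2t : A ^ 2 ≠ ∞ := ENNReal.pow_ne_top hAt
    calc ‖D x‖ₑ ^ 2 = (A ^ 2)⁻¹ * (A ^ 2 * ‖D x‖ₑ ^ 2) := by
          rw [← mul_assoc, ENNReal.inv_mul_cancel hA20 hA2t, one_mul]
      _ ≤ (A ^ 2)⁻¹ * (2 * ‖∫ y, k y • D y ∂μ‖ₑ ^ 2 + 2 * (A * B)) := by gcongr
      _ = 2 * (A ^ 2)⁻¹ * ‖∫ y, k y • D y ∂μ‖ₑ ^ 2 + 2 * ((A ^ 2)⁻¹ * A) * B := by ring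
      _ = _ := by
          rw [sq A, ENNReal.mul_inv (Or.inl hA0) (Or.inl hAt), mul_assoc A⁻¹ A⁻¹ A,
            ENNReal.inv_mul_cancel hA0 hAt, mul_one, div_eq_mul_inv, div_eq_mul_inv,
            ENNReal.mul_inv (Or.inl hA0) (Or.inl hAt)]
  exact h2.trans (by gcongr)

/-- The truncated kernel `min(j, n)`, as a real function. -/
noncomputable def truncatedKernel (j : E3 → ℝ≥0∞) (n : ℕ) (z : E3) : ℝ := (min (j z) n).toReal

lemma measurable_truncatedKernel {j : E3 → ℝ≥0∞} (hj : Measurable j) (n : ℕ) :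
    Measurable (truncatedKernel j n) :=
  (hj.min measurable_const).ennreal_toReal

lemma truncatedKernel_nonneg (j : E3 → ℝ≥0∞) (n : ℕ) (z : E3) : 0 ≤ truncatedKernel j n z :=
  ENNReal.toReal_nonneg

lemma truncatedKernel_le (j : E3 → ℝ≥0∞) (n : ℕ) (z : E3) : truncatedKernel j n z ≤ n :=
  (ENNReal.toReal_mono (ENNReal.natCast_ne_top n) (min_le_right (j z) n)).trans_eq (by simp)

lemma ofReal_truncatedKernel (j : E3 → ℝ≥0∞) (n : ℕ) (z : E3) :
    ENNReal.ofReal (truncatedKernel j n z) = min (j z) n :=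
  ENNReal.ofReal_toReal (ne_top_of_le_ne_top (ENNReal.natCast_ne_top n) (min_le_right _ _))

/-- If `j` is not integrable near the origin, the total truncated weights blow up on open sets. -/
lemma tendsto_lintegral_truncatedKernel {Ω : Set E3} (hΩ : IsOpen Ω) {j : E3 → ℝ≥0∞}
    (hj : Measurable j) (hJ3 : ∀ R : ℝ, 0 < R → (∫⁻ z in Metric.ball 0 R, j z) = ∞)
    {x : E3} (hx : x ∈ Ω) :
    Tendsto (fun n => ∫⁻ y in Ω, ENNReal.ofReal (truncatedKernel j n (x - y))) atTop (𝓝 ∞) := by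
  have htop : ∫⁻ y in Ω, j (x - y) = ∞ := by
    -- A ball about `x` lies in `Ω`, and `z = x - y` carries it to the ball about the origin where
    -- `j` is not integrable.
    obtain ⟨R, hR, hball⟩ := Metric.isOpen_iff.1 hΩ x hx
    rw [← top_le_iff, ← hJ3 R hR]
    calc ∫⁻ z in Metric.ball 0 R, j z
        = ∫⁻ z, (Metric.ball 0 R).indicator j z := (lintegral_indicator measurableSet_ball _).symm
      _ = ∫⁻ y, (Metric.ball 0 R).indicator j (x - y) := (lintegral_sub_left_eq_self _ x).symm
      _ ≤ ∫⁻ y, Ω.indicator (fun y => j (x - y)) y := by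
          refine lintegral_mono fun y => ?_
          by_cases hy : x - y ∈ Metric.ball (0 : E3) R
          · have : y ∈ Ω := hball (by
              rwa [Metric.mem_ball, dist_comm, dist_eq_norm, ← mem_ball_zero_iff])
            simp [this, hy]
          · simp [hy]
      _ = ∫⁻ y in Ω, j (x - y) := lintegral_indicator hΩ.measurableSet _
  rw [← htop]
  simp_rw [ofReal_truncatedKernel]
  refine lintegral_tendsto_of_tendsto_of_monotone (fun n => by fun_prop)
    (Eventually.of_forall fun y n p hnp => ?_) (Eventually.of_forall fun y => ?_)
  · exact min_le_min_left _ (by exact_mod_cast hnp)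
  · have h : Tendsto (fun n : ℕ => min (j (x - y)) (n : ℝ≥0∞)) atTop (𝓝 (min (j (x - y)) ∞)) :=
      tendsto_const_nhds.min ENNReal.tendsto_nat_nhds_top
    simpa using h

lemma measurable_lintegral_truncatedKernel {Ω : Set E3} {j : E3 → ℝ≥0∞} (hj : Measurable j)
    (n : ℕ) :
    Measurable fun x => ∫⁻ y in Ω, ENNReal.ofReal (truncatedKernel j n (x - y)) := by
  have := measurable_truncatedKernel hj n
  exact Measurable.lintegral_prod_right' (f := fun p : E3 × E3 =>
    ENNReal.ofReal (truncatedKernel j n (p.1 - p.2))) (by fun_prop)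

/-- Each point of `Ω` eventually leaves these sets, and pointwise convergence of indicators suffices
on a finite measure space. -/
lemma tendsto_measure_lintegral_truncatedKernel_lt {Ω : Set E3} (hΩ : IsOpen Ω)
    (hΩf : volume Ω ≠ ∞) {j : E3 → ℝ≥0∞}
    (hj : Measurable j) (hJ3 : ∀ R : ℝ, 0 < R → (∫⁻ z in Metric.ball 0 R, j z) = ∞)
    {c : ℝ≥0∞} (hc : c ≠ ∞) :
    Tendsto (fun n => volume.restrict Ω
      {x | ∫⁻ y in Ω, ENNReal.ofReal (truncatedKernel j n (x - y)) < c}) atTop (𝓝 0) := by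
  have : IsFiniteMeasure (volume.restrict Ω) := ⟨by simpa using hΩf.lt_top⟩
  have h := tendsto_measure_of_ae_tendsto_indicator_of_isFiniteMeasure (μ := volume.restrict Ω)
    (A := ∅) atTop MeasurableSet.empty (As := fun n : ℕ =>
      {x | ∫⁻ y in Ω, ENNReal.ofReal (truncatedKernel j n (x - y)) < c})
    (fun n => measurableSet_lt (measurable_lintegral_truncatedKernel hj n) measurable_const) ?_
  · simpa using h
  · filter_upwards [ae_restrict_mem hΩ.measurableSet] with x hx
    filter_upwards [(tendsto_lintegral_truncatedKernel hΩ hj hJ3 hx).eventually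
      (lt_mem_nhds hc.lt_top)] with n hn
    simpa using hn.le

lemma integrable_truncatedKernel_smul {Ω : Set E3} {j : E3 → ℝ≥0∞} (hj : Measurable j) (n : ℕ)
    (x : E3) {D : E3 → E3} (hD : Integrable D (volume.restrict Ω)) :
    Integrable (fun y => truncatedKernel j n (x - y) • D y) (volume.restrict Ω) := by
  refine hD.bdd_smul (φ := fun y => truncatedKernel j n (x - y)) n ?_ (Eventually.of_forall fun y => ?_)
  · exact ((measurable_truncatedKernel hj n).comp
      (measurable_const.sub measurable_id)).aestronglyMeasurable
  · rw [Real.norm_of_nonneg (truncatedKernel_nonneg _ _ _)]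
    exact truncatedKernel_le _ _ _

lemma measurable_integral_truncatedKernel_smul {Ω : Set E3} {j : E3 → ℝ≥0∞} (hj : Measurable j)
    (n : ℕ) {D : E3 → E3} (hD : Measurable D) :
    Measurable fun x => ∫ y in Ω, truncatedKernel j n (x - y) • D y := by
  have := measurable_truncatedKernel hj n
  refine StronglyMeasurable.measurable (StronglyMeasurable.integral_prod_right'
    (f := fun p : E3 × E3 => truncatedKernel j n (p.1 - p.2) • D p.2) ?_)
  exact Measurable.stronglyMeasurable (by fun_prop)

/-- Averages against a fixed bounded kernel converge pointwise along weakly convergent sequences. -/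
lemma tendsto_integral_truncatedKernel_smul {Ω : Set E3} (hΩf : volume Ω ≠ ∞) {j : E3 → ℝ≥0∞}
    (hj : Measurable j) (n : ℕ) {m : ℕ → L2Field Ω} {m₀ : L2Field Ω}
    (hm : ∀ g : L2Field Ω, Tendsto (fun p => inner ℝ (m p) g) atTop (𝓝 (inner ℝ m₀ g))) (x : E3) :
    Tendsto (fun p => ∫ y in Ω, truncatedKernel j n (x - y) • m p y) atTop
      (𝓝 (∫ y in Ω, truncatedKernel j n (x - y) • m₀ y)) := by
  have hfin : IsFiniteMeasure (volume.restrict Ω) := ⟨by simpa using hΩf.lt_top⟩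
  -- The `i`-th coordinate of the average is the pairing with this field, which is in `L²` because
  -- the truncated kernel is bounded and `Ω` has finite measure.
  have hg : ∀ i : Fin 3, MemLp (fun y => truncatedKernel j n (x - y) •
      EuclideanSpace.single i (1 : ℝ) : E3 → E3) 2 (volume.restrict Ω) := by
    intro i
    refine MemLp.of_bound (C := n) ?_ (Eventually.of_forall fun y => ?_)
    · exact (((measurable_truncatedKernel hj n).comp
        (measurable_const.sub measurable_id)).smul_const _).aestronglyMeasurable
    · rw [norm_smul, Real.norm_of_nonneg (truncatedKernel_nonneg _ _ _)]
      simpa using truncatedKernel_le j n (x - y)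
  have hcoord : ∀ (u : L2Field Ω) (i : Fin 3),
      (∫ y in Ω, truncatedKernel j n (x - y) • u y) i = inner ℝ u (hg i).toLp := by
    intro u i
    have hint := integrable_truncatedKernel_smul hj n x ((Lp.memLp u).integrable one_le_two)
    have h1 := (EuclideanSpace.proj (𝕜 := ℝ) i : E3 →L[ℝ] ℝ).integral_comp_comm hint
    refine h1.symm.trans ?_
    rw [L2.inner_def]
    refine integral_congr_ae ?_
    filter_upwards [(hg i).coeFn_toLp] with y hy
    rw [hy, inner_smul_right]
    simp [EuclideanSpace.inner_single_right]
  have h2 : Tendsto (fun p => (EuclideanSpace.equiv (Fin 3) ℝ)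
      (∫ y in Ω, truncatedKernel j n (x - y) • m p y)) atTop
      (𝓝 ((EuclideanSpace.equiv (Fin 3) ℝ) (∫ y in Ω, truncatedKernel j n (x - y) • m₀ y))) := by
    rw [tendsto_pi_nhds]
    intro i
    simpa [hcoord] using hm (hg i).toLp
  simpa [Function.comp_def] using
    ((EuclideanSpace.equiv (Fin 3) ℝ).symm.continuous.tendsto _).comp h2

lemma exchangeEnergy_eq_lintegral_lintegral {j : E3 → ℝ≥0∞} (hj : Measurable j) {Ω : Set E3}
    {D : E3 → E3} (hD : Measurable D) :
    ∫⁻ p : E3 × E3, j (p.1 - p.2) * ‖D p.1 - D p.2‖ₑ ^ 2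
      ∂((volume.restrict Ω).prod (volume.restrict Ω)) =
      ∫⁻ x in Ω, ∫⁻ y in Ω, j (x - y) * ‖D x - D y‖ₑ ^ 2 :=
  lintegral_prod _ (by fun_prop)

lemma lintegral_exchange_sub_le {j : E3 → ℝ≥0∞} (hj : Measurable j) {Ω : Set E3}
    (m m' : L2Field Ω) :
    ∫⁻ x in Ω, ∫⁻ y in Ω, j (x - y) * ‖(m x - m' x) - (m y - m' y)‖ₑ ^ 2 ≤
      2 * exchangeEnergy j Ω m + 2 * exchangeEnergy j Ω m' := by
  have hm : Measurable m := (Lp.stronglyMeasurable m).measurable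
  have hm' : Measurable m' := (Lp.stronglyMeasurable m').measurable
  rw [← exchangeEnergy_eq_lintegral_lintegral hj (D := fun x => m x - m' x) (hm.sub hm'),
    exchangeEnergy, exchangeEnergy, ← lintegral_const_mul _ (by fun_prop),
    ← lintegral_const_mul _ (by fun_prop), ← lintegral_add_left (by fun_prop)]
  refine lintegral_mono fun p => ?_
  calc j (p.1 - p.2) * ‖(m p.1 - m' p.1) - (m p.2 - m' p.2)‖ₑ ^ 2
      = j (p.1 - p.2) * ‖(m p.1 - m p.2) + -(m' p.1 - m' p.2)‖ₑ ^ 2 := by congr 3; abel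
    _ ≤ j (p.1 - p.2) * (2 * ‖m p.1 - m p.2‖ₑ ^ 2 + 2 * ‖-(m' p.1 - m' p.2)‖ₑ ^ 2) := by
        gcongr; exact enorm_add_sq_le _ _
    _ = _ := by rw [enorm_neg]; ring

/-- The quantitative estimate behind compactness of sublevel sets of the exchange energy. -/
lemma lintegral_enorm_sub_sq_le {Ω : Set E3} (hΩf : volume Ω ≠ ∞)
    {j : E3 → ℝ≥0∞} (hj : Measurable j) {m m' : L2Field Ω}
    (hm : ∀ᵐ x ∂(volume.restrict Ω), m x ∈ Metric.sphere (0 : E3) 1)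
    (hm' : ∀ᵐ x ∂(volume.restrict Ω), m' x ∈ Metric.sphere (0 : E3) 1) (n : ℕ) {c : ℝ≥0∞}
    (hc0 : c ≠ 0) :
    ∫⁻ x in Ω, ‖m x - m' x‖ₑ ^ 2 ≤
      4 * volume.restrict Ω
        {x | ∫⁻ y in Ω, ENNReal.ofReal (truncatedKernel j n (x - y)) < c} +
      (2 / c ^ 2 * (∫⁻ x in Ω, ‖(∫ y in Ω, truncatedKernel j n (x - y) • m y) -
          ∫ y in Ω, truncatedKernel j n (x - y) • m' y‖ₑ ^ 2) +
        2 / c * (2 * exchangeEnergy j Ω m + 2 * exchangeEnergy j Ω m')) := by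
  have hfin : IsFiniteMeasure (volume.restrict Ω) := ⟨by simpa using hΩf.lt_top⟩
  have hmm : Measurable m := (Lp.stronglyMeasurable m).measurable
  have hmm' : Measurable m' := (Lp.stronglyMeasurable m').measurable
  have hkm := measurable_truncatedKernel hj n
  have hkmx : ∀ x : E3, Measurable fun y => truncatedKernel j n (x - y) := fun x => by fun_prop
  set S := {x | ∫⁻ y in Ω, ENNReal.ofReal (truncatedKernel j n (x - y)) < c} with hS
  have hSm : MeasurableSet S :=
    measurableSet_lt (measurable_lintegral_truncatedKernel hj n) measurable_const
  have hI : ∀ x (u : L2Field Ω), Integrable (fun y => truncatedKernel j n (x - y) • u y)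
      (volume.restrict Ω) := fun x u =>
    integrable_truncatedKernel_smul hj n x ((Lp.memLp u).integrable one_le_two)
  have hmeas1 : Measurable fun x => ‖(∫ y in Ω, truncatedKernel j n (x - y) • m y) -
          ∫ y in Ω, truncatedKernel j n (x - y) • m' y‖ₑ ^ 2 :=
    (((measurable_integral_truncatedKernel_smul hj n hmm).sub
      (measurable_integral_truncatedKernel_smul hj n hmm')).enorm).pow_const 2
  refine le_trans ?_ (add_le_add_right (add_le_add_right (mul_le_mul_right
    (lintegral_exchange_sub_le hj m m') _) _) _)
  have hmeas2 : Measurable fun x => ∫⁻ y in Ω, j (x - y) * ‖(m x - m' x) - (m y - m' y)‖ₑ ^ 2 :=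
    Measurable.lintegral_prod_right' (f := fun p : E3 × E3 =>
      j (p.1 - p.2) * ‖(m p.1 - m' p.1) - (m p.2 - m' p.2)‖ₑ ^ 2) (by fun_prop)
  rw [← lintegral_indicator_const hSm, ← lintegral_const_mul _ hmeas1,
    ← lintegral_const_mul _ hmeas2, ← lintegral_add_left (hmeas1.const_mul _),
    ← lintegral_add_left (measurable_const.indicator hSm)]
  refine lintegral_mono_ae ?_
  filter_upwards [hm, hm'] with x hx hx'
  -- On the bad set the crude bound `|m - m'| ≤ 2` gives the factor 4; off it the weight is at least
  -- `c`.
  by_cases hxS : x ∈ S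
  · refine le_trans ?_ le_self_add
    rw [Set.indicator_of_mem hxS]
    have h2 : ‖m x - m' x‖ₑ ≤ 2 := by
      refine (enorm_sub_le).trans ?_
      rw [mem_sphere_zero_iff_norm] at hx hx'
      rw [← ofReal_norm, ← ofReal_norm, hx, hx']
      norm_num
    calc ‖m x - m' x‖ₑ ^ 2 ≤ 2 ^ 2 := by gcongr
      _ = 4 := by norm_num
  · refine le_trans ?_ le_add_self
    have hcx : c ≤ ∫⁻ y in Ω, ENNReal.ofReal (truncatedKernel j n (x - y)) := not_lt.1 hxS
    have hkint : Integrable (fun y => truncatedKernel j n (x - y)) (volume.restrict Ω) := by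
      refine Integrable.of_bound (hkmx x).aestronglyMeasurable n (Eventually.of_forall fun y => ?_)
      rw [Real.norm_of_nonneg (truncatedKernel_nonneg _ _ _)]
      exact truncatedKernel_le _ _ _
    have hDint : Integrable (fun y => truncatedKernel j n (x - y) • (m y - m' y))
        (volume.restrict Ω) := by
      simp_rw [smul_sub]
      exact (hI x m).sub (hI x m')
    have key := enorm_sq_le_of_weight hkint (hkmx x) (fun y => truncatedKernel_nonneg _ _ _)
      (D := fun y => m y - m' y) (hmm.sub hmm') hDint x hc0 hcx
    refine key.trans ?_
    simp_rw [smul_sub]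
    rw [integral_sub (hI x m) (hI x m')]
    gcongr with y
    rw [ofReal_truncatedKernel]
    exact min_le_left _ _

lemma edist_eq_lintegral_sq {Ω : Set E3} (m m' : L2Field Ω) :
    edist m m' ^ 2 = ∫⁻ x in Ω, ‖m x - m' x‖ₑ ^ 2 := by
  rw [Lp.edist_def, eLpNorm_eq_lintegral_rpow_enorm_toReal two_ne_zero ENNReal.ofNat_ne_top,
    ← ENNReal.rpow_natCast, ← ENNReal.rpow_mul]
  simp

lemma norm_le_of_ae_mem_sphere {Ω : Set E3} [IsFiniteMeasure (volume.restrict Ω)] {m : L2Field Ω}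
    (hm : ∀ᵐ x ∂(volume.restrict Ω), m x ∈ Metric.sphere (0 : E3) 1) :
    ‖m‖ ≤ (measureUnivNNReal (volume.restrict Ω) : ℝ) ^ (2⁻¹ : ℝ) := by
  refine (Lp.norm_le_of_ae_bound (C := 1) zero_le_one ?_).trans (by simp)
  filter_upwards [hm] with x hx
  exact (mem_sphere_zero_iff_norm.1 hx).le

/-- Sphere-valued sequences with bounded exchange energy are relatively compact in `L²(Ω)`. -/
theorem exists_subseq_tendsto_of_exchangeEnergy_le {Ω : Set E3} (hΩ : IsOpen Ω)
    (hΩf : volume Ω ≠ ∞) {j : E3 → ℝ≥0∞} (hj : Measurable j)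
    (hJ3 : ∀ R : ℝ, 0 < R → (∫⁻ z in Metric.ball 0 R, j z) = ∞) {m : ℕ → L2Field Ω}
    (hm : ∀ p, ∀ᵐ x ∂(volume.restrict Ω), m p x ∈ Metric.sphere (0 : E3) 1) {C : ℝ≥0∞}
    (hC : C ≠ ∞) (hmC : ∀ p, exchangeEnergy j Ω (m p) ≤ C) :
    ∃ m₀ : L2Field Ω, ∃ φ : ℕ → ℕ, StrictMono φ ∧ Tendsto (m ∘ φ) atTop (𝓝 m₀) := by
  have hfin : IsFiniteMeasure (volume.restrict Ω) := ⟨by simpa using hΩf.lt_top⟩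
  have hsep : SecondCountableTopology (L2Field Ω) :=
    have : Fact ((2 : ℝ≥0∞) ≠ ∞) := ⟨ENNReal.ofNat_ne_top⟩
    Lp.SecondCountableTopology
  obtain ⟨w, φ, hφ, hw⟩ := exists_subseq_tendsto_inner fun p => norm_le_of_ae_mem_sphere (hm p)
  -- Completeness supplies the strong limit, so it need not be identified with the weak limit `w`.
  suffices h : CauchySeq (m ∘ φ) by
    obtain ⟨m₀, hm₀⟩ := cauchySeq_tendsto_of_complete h
    exact ⟨m₀, φ, hφ, hm₀⟩
  set u := m ∘ φ
  let T : ℕ → ℕ → E3 → E3 := fun n p x => ∫ y in Ω, truncatedKernel j n (x - y) • u p y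
  have hum : ∀ p, Measurable (u p) := fun p => (Lp.stronglyMeasurable (u p)).measurable
  have hTm : ∀ n p, Measurable (T n p) := fun n p =>
    measurable_integral_truncatedKernel_smul hj n (hum p)
  have hTb : ∀ n p x, ‖T n p x‖ₑ ≤ n * volume Ω := by
    intro n p x
    refine (enorm_integral_le_lintegral_enorm _).trans ?_
    calc ∫⁻ y in Ω, ‖truncatedKernel j n (x - y) • u p y‖ₑ ≤ ∫⁻ _ in Ω, (n : ℝ≥0∞) := by
          refine lintegral_mono_ae ?_
          filter_upwards [hm (φ p)] with y hy
          have hy1 : ‖u p y‖ = 1 := mem_sphere_zero_iff_norm.1 hy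
          rw [← ofReal_norm, norm_smul, Real.norm_of_nonneg (truncatedKernel_nonneg _ _ _), hy1,
            mul_one, ofReal_truncatedKernel]
          exact min_le_right _ _
      _ = n * volume Ω := by simp
  have hTlim : ∀ n, Tendsto (fun q : ℕ × ℕ => ∫⁻ x in Ω, ‖T n q.1 x - T n q.2 x‖ₑ ^ 2) atTop
      (𝓝 0) := by
    intro n
    have h := tendsto_lintegral_filter_of_dominated_convergence (μ := volume.restrict Ω)
      (l := (atTop : Filter (ℕ × ℕ)))
      (F := fun q x => ‖T n q.1 x - T n q.2 x‖ₑ ^ 2) (f := fun _ => 0)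
      (fun _ => (n * volume Ω + n * volume Ω) ^ 2) ?_ ?_ ?_ ?_
    · simpa using h
    · exact Eventually.of_forall fun q =>
        (((hTm n q.1).sub (hTm n q.2)).enorm).pow_const 2
    · refine Eventually.of_forall fun q => Eventually.of_forall fun x => ?_
      have := (enorm_sub_le (a := T n q.1 x) (b := T n q.2 x)).trans
        (add_le_add (hTb n q.1 x) (hTb n q.2 x))
      gcongr
    · rw [lintegral_const]
      have hnv : (n : ℝ≥0∞) * volume Ω ≠ ∞ := ENNReal.mul_ne_top (ENNReal.natCast_ne_top n) hΩf
      exact ENNReal.mul_ne_top (ENNReal.pow_ne_top (ENNReal.add_ne_top.2 ⟨hnv, hnv⟩))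
        (measure_ne_top _ _)
    · refine Eventually.of_forall fun x => ?_
      have h1 := tendsto_integral_truncatedKernel_smul hΩf hj n hw x
      rw [← prod_atTop_atTop_eq]
      have h2 := (h1.comp tendsto_fst).sub (h1.comp (tendsto_snd (f := (atTop : Filter ℕ))))
      rw [sub_self] at h2
      simpa [T, u, Function.comp_def] using ENNReal.Tendsto.pow (n := 2) h2.enorm
  have hsq : Tendsto (fun q : ℕ × ℕ => edist (u q.1) (u q.2) ^ 2) atTop (𝓝 0) := by
    simp_rw [edist_eq_lintegral_sq]
    rw [ENNReal.tendsto_nhds_zero]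
    intro ε hε
    rcases eq_or_ne ε ∞ with rfl | hεt
    · simp
    have hε3 : ε / 3 ≠ 0 := (ENNReal.div_pos hε.ne' (by simp)).ne'
    have hε3t : ε / 3 ≠ ∞ := ENNReal.div_ne_top hεt (by simp)
    -- `K` bounds the energy factor, the `+ 1` keeping it nonzero when `C = 0`; `c` is then chosen
    -- to make `2 / c * K` at most `ε / 3`.
    let K : ℝ≥0∞ := 2 * C + 2 * C + 1
    have hK0 : K ≠ 0 := by simp [K]
    have hKt : K ≠ ∞ := by simp [K, ENNReal.mul_ne_top, hC]
    let c : ℝ≥0∞ := 2 * K / (ε / 3)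
    have hc0 : c ≠ 0 := (ENNReal.div_pos (by simp [hK0]) hε3t).ne'
    have hct : c ≠ ∞ := ENNReal.div_ne_top (ENNReal.mul_ne_top (by simp) hKt) hε3
    have hcK : 2 / c * K ≤ ε / 3 := by
      have : 2 / c * K = 2 * K / c := by
        rw [div_eq_mul_inv, div_eq_mul_inv]; ring
      rw [this]
      refine ENNReal.div_le_of_le_mul ?_
      rw [ENNReal.mul_div_cancel hε3 hε3t]
    obtain ⟨n, hn⟩ : ∃ n, 4 * volume.restrict Ω
        {x | ∫⁻ y in Ω, ENNReal.ofReal (truncatedKernel j n (x - y)) < c} ≤ ε / 3 := by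
      have h1 := ENNReal.Tendsto.const_mul (a := 4)
        (tendsto_measure_lintegral_truncatedKernel_lt hΩ hΩf hj hJ3 hct)
        (Or.inr ENNReal.ofNat_ne_top)
      rw [mul_zero] at h1
      exact ((ENNReal.tendsto_nhds_zero.1 h1) _ (pos_iff_ne_zero.2 hε3)).exists
    have h2 := ENNReal.Tendsto.const_mul (a := 2 / c ^ 2) (hTlim n)
      (Or.inr (ENNReal.div_ne_top ENNReal.ofNat_ne_top (pow_ne_zero 2 hc0)))
    rw [mul_zero] at h2
    filter_upwards [(ENNReal.tendsto_nhds_zero.1 h2) _ (pos_iff_ne_zero.2 hε3)] with q hq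
    refine (lintegral_enorm_sub_sq_le hΩf hj (hm (φ q.1)) (hm (φ q.2)) n
      hc0).trans ?_
    have h3 : 2 / c * (2 * exchangeEnergy j Ω (u q.1) + 2 * exchangeEnergy j Ω (u q.2)) ≤ ε / 3 := by
      refine le_trans ?_ hcK
      gcongr
      refine le_trans ?_ le_self_add
      exact add_le_add (mul_le_mul_right (hmC _) 2) (mul_le_mul_right (hmC _) 2)
    calc _ ≤ ε / 3 + (ε / 3 + ε / 3) := add_le_add hn (add_le_add hq h3)
      _ = ε := by rw [← add_assoc, ENNReal.add_thirds]
  have hed : Tendsto (fun q : ℕ × ℕ => edist (u q.1) (u q.2)) atTop (𝓝 0) := by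
    have h := hsq.ennrpow_const (2⁻¹ : ℝ)
    rw [ENNReal.zero_rpow_of_pos (by norm_num)] at h
    refine h.congr fun q => ?_
    rw [← ENNReal.rpow_natCast, ← ENNReal.rpow_mul]
    norm_num
  rw [cauchySeq_iff_tendsto_dist_atTop_0]
  have := (ENNReal.tendsto_toReal ENNReal.zero_ne_top).comp hed
  simpa [Function.comp_def, edist_dist] using this

end Compactness

/-! ### Lower semicontinuity and the direct method. -/

/-- Lower semicontinuity of the exchange energy along almost everywhere convergent sequences. -/
lemma exchangeEnergy_le_of_tendsto {Ω : Set E3} (hΩf : volume Ω ≠ ∞) {j : E3 → ℝ≥0∞}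
    (hj : Measurable j) {u : ℕ → L2Field Ω} {m : L2Field Ω}
    (hae : ∀ᵐ x ∂(volume.restrict Ω), Tendsto (fun p => u p x) atTop (𝓝 (m x))) {L : ℝ≥0∞}
    (hL : Tendsto (fun p => exchangeEnergy j Ω (u p)) atTop (𝓝 L)) :
    exchangeEnergy j Ω m ≤ L := by
  have hfin : IsFiniteMeasure (volume.restrict Ω) := ⟨by simpa using hΩf.lt_top⟩
  have hum : ∀ p, Measurable (u p) := fun p => (Lp.stronglyMeasurable (u p)).measurable
  rw [← hL.liminf_eq]
  refine le_trans (lintegral_mono_ae ?_) (lintegral_liminf_le fun p => ?_)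
  · filter_upwards [Measure.quasiMeasurePreserving_fst.ae hae,
      Measure.quasiMeasurePreserving_snd.ae hae] with q h1 h2
    -- Where `j = ∞`, multiplication by `j` is discontinuous at 0, so a vanishing limit is treated
    -- separately; there the bound is trivial.
    rcases eq_or_ne (‖m q.1 - m q.2‖ₑ ^ 2) 0 with h0 | h0
    · rw [h0, mul_zero]; exact zero_le
    · exact (ENNReal.Tendsto.const_mul (ENNReal.Tendsto.pow (h1.sub h2).enorm) (Or.inl h0)).liminf_eq.ge
  · have := hum p
    fun_prop

/-- Subtraction pulls null sets back to null sets of the product, so an a.e.-measurable kernel may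
be replaced by a measurable representative. -/
lemma exchangeEnergy_congr {Ω : Set E3} {j j' : E3 → ℝ≥0∞} (h : j =ᵐ[volume] j') :
    exchangeEnergy j Ω = exchangeEnergy j' Ω := by
  ext m
  refine lintegral_congr_ae ?_
  have hac : (volume.restrict Ω).prod (volume.restrict Ω) ≪
      (volume : Measure E3).prod volume :=
    Measure.AbsolutelyContinuous.prod Measure.restrict_le_self.absolutelyContinuous
      Measure.restrict_le_self.absolutelyContinuous
  filter_upwards [hac.ae_le ((quasiMeasurePreserving_sub (volume : Measure E3) volume).ae h)] with p hp
  rw [hp]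

lemma exists_mem_finiteEnergySpace {Ω : Set E3} (hΩf : volume Ω ≠ ∞) (j : E3 → ℝ≥0∞) :
    (finiteEnergySpace j Ω).Nonempty := by
  have hfin : IsFiniteMeasure (volume.restrict Ω) := ⟨by simpa using hΩf.lt_top⟩
  let e : E3 := EuclideanSpace.single 0 1
  have hc := (memLp_const (p := 2) (μ := volume.restrict Ω) e).coeFn_toLp
  refine ⟨(memLp_const e).toLp, ?_, ?_⟩
  · filter_upwards [hc] with x hx
    rw [hx]; simp [e]
  · have : exchangeEnergy j Ω (memLp_const e).toLp = 0 := by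
      rw [exchangeEnergy]
      refine (lintegral_congr_ae ?_).trans lintegral_zero
      filter_upwards [Measure.quasiMeasurePreserving_fst.ae hc,
        Measure.quasiMeasurePreserving_snd.ae hc] with q h1 h2
      rw [h1, h2]; simp
    rw [this]; simp

/-- The micromagnetic energy attains its minimum on the sphere-valued fields of finite energy. -/
theorem exists_minimizer {Ω : Set E3} (hΩ : IsOpen Ω) (hΩf : volume Ω ≠ ∞) {j : E3 → ℝ≥0∞}
    (hj : Measurable j) (hJ3 : ∀ R : ℝ, 0 < R → (∫⁻ z in Metric.ball 0 R, j z) = ∞) :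
    ∃ m ∈ finiteEnergySpace j Ω, ∀ m' ∈ finiteEnergySpace j Ω,
      micromagneticEnergy j Ω m ≤ micromagneticEnergy j Ω m' := by
  have hW0 := magnetostaticEnergy_nonneg hΩ.measurableSet
  have hE0 : ∀ m, 0 ≤ micromagneticEnergy j Ω m := fun m =>
    add_nonneg ENNReal.toReal_nonneg (hW0 m)
  let S := micromagneticEnergy j Ω '' finiteEnergySpace j Ω
  have hbdd : BddBelow S := ⟨0, by rintro _ ⟨m, -, rfl⟩; exact hE0 m⟩
  obtain ⟨v, hv_anti, hv, hvS⟩ := exists_seq_tendsto_sInf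
    ((exists_mem_finiteEnergySpace hΩf j).image (micromagneticEnergy j Ω)) hbdd
  choose m hmS hmv using hvS
  -- The magnetostatic energy is nonnegative, so the exchange energy is at most the total energy `v
  -- p ≤ v 0`.
  have hJle : ∀ p, exchangeEnergy j Ω (m p) ≤ ENNReal.ofReal (v 0) := by
    intro p
    rw [← ENNReal.ofReal_toReal (hmS p).2.ne]
    refine ENNReal.ofReal_le_ofReal ?_
    have h1 := hv_anti (Nat.zero_le p)
    have h2 := hmv p
    have h3 := hW0 (m p)
    rw [micromagneticEnergy] at h2
    linarith
  obtain ⟨m₀, φ, hφ, hlim⟩ := exists_subseq_tendsto_of_exchangeEnergy_le hΩ hΩf hj hJ3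
    (fun p => (hmS p).1) ENNReal.ofReal_ne_top hJle
  obtain ⟨ψ, hψ, hae⟩ := (tendstoInMeasure_of_tendsto_Lp hlim).exists_seq_tendsto_ae
  have hφψ : Tendsto (fun p => φ (ψ p)) atTop atTop := hφ.tendsto_atTop.comp hψ.tendsto_atTop
  have hWlim : Tendsto (fun p => magnetostaticEnergy Ω (m (φ (ψ p)))) atTop
      (𝓝 (magnetostaticEnergy Ω m₀)) :=
    ((continuous_magnetostaticEnergy hΩ.measurableSet).tendsto m₀).comp
      (hlim.comp hψ.tendsto_atTop)
  -- The total and magnetostatic energies both converge, hence so does the exchange energy; Fatou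
  -- against this limit yields `E(m₀) ≤ inf E`.
  have hJlim : Tendsto (fun p => (exchangeEnergy j Ω (m (φ (ψ p)))).toReal) atTop
      (𝓝 (sInf S - magnetostaticEnergy Ω m₀)) := by
    refine ((hv.comp hφψ).sub hWlim).congr fun p => ?_
    simp [← hmv, micromagneticEnergy]
  have hJ0 : 0 ≤ sInf S - magnetostaticEnergy Ω m₀ :=
    ge_of_tendsto' hJlim fun _ => ENNReal.toReal_nonneg
  have hJ := exchangeEnergy_le_of_tendsto hΩf hj hae
    ((ENNReal.tendsto_ofReal hJlim).congr fun p => ENNReal.ofReal_toReal (hmS _).2.ne)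
  refine ⟨m₀, ⟨?_, hJ.trans_lt ENNReal.ofReal_lt_top⟩, fun m' hm' => ?_⟩
  · filter_upwards [hae, ae_all_iff.2 fun p => (hmS p).1] with x hx h1
    exact Metric.isClosed_sphere.mem_of_tendsto hx (Eventually.of_forall fun p => h1 _)
  · have h1 := ENNReal.toReal_le_of_le_ofReal hJ0 hJ
    have h2 : sInf S ≤ micromagneticEnergy j Ω m' := csInf_le hbdd ⟨m', hm', rfl⟩
    rw [micromagneticEnergy]
    linarith

end Micromagnetics

theorem mainTheorem6
    (Ω : Set Micromagnetics.E3) (hΩ_open : IsOpen Ω) (hΩ_bdd : Bornology.IsBounded Ω)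
    (j : Micromagnetics.E3 → ℝ≥0∞) (hj_meas : AEMeasurable j volume)
    (hJ1 : ∀ z, j (-z) = j z)
    (hJ2 : (∫⁻ z, ENNReal.ofReal (min 1 (‖z‖ ^ 2)) * j z) < ∞)
    (hJ3 : ∀ R : ℝ, 0 < R → (∫⁻ z in Metric.ball 0 R, j z) = ∞) :
    (∀ m : Micromagnetics.L2Field Ω, ∃! h : Lp Micromagnetics.E3 2 (volume : Measure Micromagnetics.E3),
      Micromagnetics.IsDemagField Ω m h) ∧
    ∃ m ∈ Micromagnetics.finiteEnergySpace j Ω,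
      ∀ m' ∈ Micromagnetics.finiteEnergySpace j Ω,
        Micromagnetics.micromagneticEnergy j Ω m ≤ Micromagnetics.micromagneticEnergy j Ω m' := by
  refine ⟨Micromagnetics.existsUnique_isDemagField hΩ_open.measurableSet, ?_⟩
  have hJ3' : ∀ R : ℝ, 0 < R → (∫⁻ z in Metric.ball 0 R, hj_meas.mk j z) = ∞ := fun R hR => by
    rw [← hJ3 R hR]
    exact lintegral_congr_ae (ae_restrict_of_ae hj_meas.ae_eq_mk.symm)
  have h := Micromagnetics.exists_minimizer hΩ_open hΩ_bdd.measure_lt_top.ne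
    hj_meas.measurable_mk hJ3'
  simpa only [Micromagnetics.finiteEnergySpace, Micromagnetics.micromagneticEnergy,
    Micromagnetics.exchangeEnergy_congr hj_meas.ae_eq_mk] using h
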